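/- A partition $\lambda=(\lambda_1,\dots,\lambda_r)$ (with $\lambda_1\ge\dots\ge\lambda_r\ge1$) is identified with its Young diagram $D(\lambda)=\{(i,j)\in\mathbb{Z}^2 : 1\le i\le r,\ 1\le j\le\lambda_i\}$, and $\lambda'=(\lambda'_1,\dots,\lambda'_s)$ is its conjugate, $\lambda'_i=\#\{j : \lambda_j\ge i\}$. A box $(i,j)\in D(\lambda)$ is a corner if $(i+1,j)\notin D(\lambda)$ and $(i,j+1)\notin D(\lambda)$. Let $\mathrm{SSYT}(\lambda)$ be the set of fillings $M=(m_{ij})$ of $D(\lambda)$ by positive integers that are weakly increasing along each row (left to right) and strictly increasing down each column. For $\boldsymbol{s}=(s_{ij})_{(i,j)\in D(\lambda)}$ with $s_{ij}\in\mathbb{C}$ put $$\zeta_\lambda(\boldsymbol{s})=\sum_{M\in\mathrm{SSYT}(\lambda)}\ \prod_{(i,j)\in D(\lambda)} m_{ij}^{-s_{ij}},$$ and for $s_1,\dots,s_n\in\mathbb{C}$ put $$\zeta(s_1,\dots,s_n)=\sum_{0<m_1<\cdots<m_n}\frac{1}{m_1^{s_1}\cdots m_n^{s_n}},\qquad \zeta^\star(s_1,\dots,s_n)=\sum_{0<m_1\le\cdots\le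 m_n}\frac{1}{m_1^{s_1}\cdots m_n^{s_n}}.$$ **Theorem.** Let $\lambda=(\lambda_1,\dots,\lambda_r)$ be a partition with conjugate $\lambda'=(\lambda'_1,\dots,\lambda'_s)$, and let $\boldsymbol{s}=(s_{ij})$ be a filling of $D(\lambda)$ by complex numbers such that $\mathrm{Re}(s_{ij})\ge1$ if $(i,j)$ is not a corner, $\mathrm{Re}(s_{ij})>1$ if $(i,j)$ is a corner, and $s_{ij}=s_{kl}$ whenever $j-i=l-k$. Write $a_k=s_{i,i+k}$. Then the series $\zeta_\lambda(\boldsymbol{s})$ converges absolutely, and the following hold. 1. ($H$-type) If moreover $\mathrm{Re}(s_{i,\lambda_i})>1$ for all $1\le i\le r$, then $$\zeta_\lambda(\boldsymbol{s})=\det\left[\zeta^\star(a_{-j+1},a_{-j+2},\dots,a_{-j+(\lambda_i-i+j)})\right]_{1\le i,j\le r},$$ where the entry is understood to be $1$ if $\lambda_i-i+j=0$ and $0$ if $\lambda_i-i+j<0$, and the series defining each of the other entries converges absolutely. 2. ($E$-type) If moreover $\mathrm{Re}(s_{\lambda'_i,i})>1$ for all $1\le i\le s$, then $$\zeta_\lambda(\boldsymbol{s})=\det\left[\zeta(a_{j-1},a_{j-2},\dots,a_{j-(\lambda'_i-i+j)})\right]_{1\le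 i,j\le s},$$ where the entry is understood to be $1$ if $\lambda'_i-i+j=0$ and $0$ if $\lambda'_i-i+j<0$, and the series defining each of the other entries converges absolutely. -/

import Mathlib

/-! Rows and columns of a Young diagram `μ` are numbered from `0`, as in Mathlib: the box in the
`(i+1)`-st row and `(j+1)`-st column is `(i, j)`, the length of the `(i+1)`-st row is
`μ.rowLen i` and that of the `(j+1)`-st column is `μ.colLen j`. So `μ.colLen 0` is the number of
rows and `μ.rowLen 0` is the number of columns. The content (column minus row) of a box does not
depend on this choice. -/

namespace SchurZeta

/-- Young tableaux of shape `μ` over `X`: arbitrary fillings of the boxes of `μ`. -/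
abbrev Tableau (μ : YoungDiagram) (X : Type*) : Type _ := μ.cells → X

/-- The fillings that are constant along the diagonals. -/
def diagTableaux (μ : YoungDiagram) (X : Type*) : Set (Tableau μ X) :=
  {t | ∀ c d : μ.cells,
    ((c.1.2 : ℤ) - (c.1.1 : ℤ) = (d.1.2 : ℤ) - (d.1.1 : ℤ)) → t c = t d}

/-- A corner of `μ`: a box with no box of `μ` directly below it or directly to its right. -/
def IsCorner (μ : YoungDiagram) (c : ℕ × ℕ) : Prop :=
  c ∈ μ ∧ (c.1 + 1, c.2) ∉ μ ∧ (c.1, c.2 + 1) ∉ μ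

/-- The region `W_μ`: real part at least `1` on all boxes that are not corners, and greater than
`1` on the corners. -/
def region (μ : YoungDiagram) : Set (Tableau μ ℂ) :=
  {s | ∀ c : μ.cells,
    (¬ IsCorner μ c.1 → 1 ≤ (s c).re) ∧ (IsCorner μ c.1 → 1 < (s c).re)}

/-- `W_μ^diag`. -/
def diagRegion (μ : YoungDiagram) : Set (Tableau μ ℂ) :=
  region μ ∩ diagTableaux μ ℂ

/-- Semi-standard Young tableaux of shape `μ` whose entries are positive integers (Mathlib's
semi-standard tableaux may have the entry `0`, and take the value `0` outside of `μ`). -/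
def SSYT (μ : YoungDiagram) : Type :=
  {M : SemistandardYoungTableau μ // ∀ i j : ℕ, (i, j) ∈ μ → 0 < M i j}

/-- The summand `1 / M ^ s`, where `M ^ s` is the product of `m_ij ^ s_ij` over all boxes. -/
noncomputable def schurTerm {μ : YoungDiagram} (s : Tableau μ ℂ) (M : SSYT μ) : ℂ :=
  1 / ∏ c : μ.cells, (M.1 c.1.1 c.1.2 : ℂ) ^ (s c)

/-- The Schur multiple zeta function of shape `μ`. -/
noncomputable def schurZeta {μ : YoungDiagram} (s : Tableau μ ℂ) : ℂ :=
  ∑' M : SSYT μ, schurTerm s M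

/-- Sequences of positive integers `m_1 < ⋯ < m_n`. -/
def StrictSeq (n : ℕ) : Type := {m : Fin n → ℕ // StrictMono m ∧ ∀ k, 0 < m k}

/-- Sequences of positive integers `m_1 ≤ ⋯ ≤ m_n`. -/
def WeakSeq (n : ℕ) : Type := {m : Fin n → ℕ // Monotone m ∧ ∀ k, 0 < m k}

/-- The summand `1 / (m_1 ^ s_1 ⋯ m_n ^ s_n)`. -/
noncomputable def seqTerm {n : ℕ} (s : Fin n → ℂ) (m : Fin n → ℕ) : ℂ :=
  1 / ∏ k : Fin n, (m k : ℂ) ^ (s k)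

/-- The multiple zeta function `ζ(s_1, …, s_n)`. -/
noncomputable def multipleZeta {n : ℕ} (s : Fin n → ℂ) : ℂ :=
  ∑' m : StrictSeq n, seqTerm s m.1

/-- The multiple zeta-star function `ζ⋆(s_1, …, s_n)`. -/
noncomputable def multipleZetaStar {n : ℕ} (s : Fin n → ℂ) : ℂ :=
  ∑' m : WeakSeq n, seqTerm s m.1

theorem multipleZeta_zero (s : Fin 0 → ℂ) : multipleZeta s = 1 := by
  haveI : Unique (StrictSeq 0) :=
    { default := ⟨Fin.elim0, fun i => i.elim0, fun i => i.elim0⟩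
      uniq := fun m => Subtype.ext (Subsingleton.elim _ _) }
  rw [multipleZeta, tsum_eq_single default (fun b hb => absurd (Unique.eq_default b) hb)]
  simp [seqTerm]

theorem multipleZetaStar_zero (s : Fin 0 → ℂ) : multipleZetaStar s = 1 := by
  haveI : Unique (WeakSeq 0) :=
    { default := ⟨Fin.elim0, fun i => i.elim0, fun i => i.elim0⟩
      uniq := fun m => Subtype.ext (Subsingleton.elim _ _) }
  rw [multipleZetaStar, tsum_eq_single default (fun b hb => absurd (Unique.eq_default b) hb)]
  simp [seqTerm]

/-- `ζ(f 0, f 1, …, f (L - 1))`, with the convention that this is `0` if `L < 0`. If `L = 0` it is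
`1`, see `multipleZeta_zero`. -/
noncomputable def zetaOfLength (L : ℤ) (f : ℕ → ℂ) : ℂ :=
  if L < 0 then 0 else multipleZeta (fun k : Fin L.toNat => f k)

/-- `ζ⋆(f 0, f 1, …, f (L - 1))`, with the convention that this is `0` if `L < 0`. If `L = 0` it is
`1`, see `multipleZetaStar_zero`. -/
noncomputable def zetaStarOfLength (L : ℤ) (f : ℕ → ℂ) : ℂ :=
  if L < 0 then 0 else multipleZetaStar (fun k : Fin L.toNat => f k)

end SchurZeta

/-!
Cut off all sums at entries at most `n`. The truncated identities are identities between finite sums,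
valid for arbitrary weights `x c m` of an entry `m` at content `c`; absolute convergence of all
series then lets `n` tend to infinity.

For the `H`-type identity, consider tableaux whose entries are at most `n` in the first `i` rows and
at most `n + 1` in the others. Such a tableau either has no `n + 1` in row `i`, or has `n + 1` in the
last box of that row. In the latter case the box has to be a corner, since entries increase down the
columns, and it can be removed. This gives a recursion for the generating function
(`fillingSum_rowFlag_of_lt`, `fillingSum_rowFlag_of_eq`). The determinant, whose row `i` is made of
sums over sequences with the same bounds, satisfies the same recursion: whether the last term of a
sequence is `n + 1` expresses row `i` as a combination of two rows, and the determinant is linear in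
that row (`det_jacobiTrudi_succ`). If the last box of row `i` is not a corner, the second determinant
has two equal rows or a zero row (`det_jacobiTrudi_eq_zero`). Induction on `n`, on `i` and on the size
of the diagram proves the identity (`fillingSum_eq_det_rowLen`). The `E`-type identity is proved in
the same way, by removing entries `n + 1` from the bottoms of the columns from right to left
(`fillingSum_eq_det_colLen`).

For the convergence, every entry of a tableau is at most the entry of some corner, so that the surplus
of the exponents over `1` at the corners can be distributed over all boxes. The series is then
dominated by a product of series `∑ m ^ (-1 - δ)` (`summable_of_dominated`). The same argument applies
to monotone sequences, with the last position in place of the corners.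
-/

namespace SchurZeta

open Filter Topology

variable {R : Type*} [CommRing R]

/-! ### Bounded tableaux and removal of a corner -/

/-- The semi-standard fillings `T` of `μ` with `1 ≤ T c ≤ B c` on every box `c` of `μ`, as functions
on all of `ℕ × ℕ` that vanish outside of `μ`. -/
def fillings (μ : YoungDiagram) (B : ℕ × ℕ → ℕ) : Set (ℕ × ℕ → ℕ) :=
  {T | (∀ c ∈ μ, 0 < T c ∧ T c ≤ B c) ∧ (∀ c ∉ μ, T c = 0) ∧
    (∀ i j₁ j₂, j₁ < j₂ → (i, j₂) ∈ μ → T (i, j₁) ≤ T (i, j₂)) ∧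
    (∀ i₁ i₂ j, i₁ < i₂ → (i₂, j) ∈ μ → T (i₁, j) < T (i₂, j))}

theorem fillings_finite (μ : YoungDiagram) (B : ℕ × ℕ → ℕ) : (fillings μ B).Finite := by
  refine Set.Finite.of_injOn (f := fun T (c : μ.cells) => T c.1)
    (t := {f | ∀ c : μ.cells, f c ∈ Set.Iic (B c.1)}) ?_ ?_
    (Set.Finite.pi' fun c => Set.finite_Iic _)
  · intro T hT c
    exact (hT.1 c.1 c.2).2
  · intro T hT T' hT' h
    funext c
    by_cases hc : c ∈ μ
    · exact congrFun h ⟨c, hc⟩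
    · rw [hT.2.1 c hc, hT'.2.1 c hc]

theorem mem_fillings_of_le {μ : YoungDiagram} {B B' : ℕ × ℕ → ℕ} {T : ℕ × ℕ → ℕ}
    (hT : T ∈ fillings μ B) (h : ∀ c ∈ μ, T c ≤ B' c) : T ∈ fillings μ B' :=
  ⟨fun c hc => ⟨(hT.1 c hc).1, h c hc⟩, hT.2⟩

/-- The generating function of the semi-standard fillings of `μ` bounded by `B`, where the entry `m`
in the box `c` contributes the factor `w c m`. -/
noncomputable def fillingSum (w : ℕ × ℕ → ℕ → R) (μ : YoungDiagram) (B : ℕ × ℕ → ℕ) : R :=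
  ∑ᶠ T ∈ fillings μ B, ∏ c ∈ μ.cells, w c (T c)

/-- The Young diagram obtained from `μ` by removing a corner. -/
def eraseCorner (μ : YoungDiagram) (c : ℕ × ℕ) (hc : IsCorner μ c) : YoungDiagram where
  cells := μ.cells.erase c
  isLowerSet := by
    rintro ⟨i, j⟩ ⟨i', j'⟩ hle hmem
    obtain ⟨c₁, c₂⟩ := c
    obtain ⟨hi, hj⟩ : i' ≤ i ∧ j' ≤ j := hle
    simp only [Finset.coe_erase, Set.mem_sdiff, Finset.mem_coe, YoungDiagram.mem_cells,
      Set.mem_singleton_iff, Prod.mk.injEq] at hmem ⊢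
    refine ⟨μ.up_left_mem hi hj hmem.1, fun h => ?_⟩
    obtain ⟨rfl, rfl⟩ := h
    rcases hi.lt_or_eq with h | h
    · exact hc.2.1 (μ.up_left_mem h hj hmem.1)
    · rcases hj.lt_or_eq with h' | h'
      · exact hc.2.2 (μ.up_left_mem hi h' hmem.1)
      · exact hmem.2 ⟨h.symm, h'.symm⟩

theorem mem_eraseCorner {μ : YoungDiagram} {c : ℕ × ℕ} (hc : IsCorner μ c) {d : ℕ × ℕ} :
    d ∈ eraseCorner μ c hc ↔ d ≠ c ∧ d ∈ μ := by
  rw [← YoungDiagram.mem_cells, eraseCorner, Finset.mem_erase, YoungDiagram.mem_cells]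

/-- A filling of `μ` bounded by `B` either has an entry at most `n` in the corner `c`, or arises by
adding the entry `n + 1` in `c` to a filling of the diagram without `c`. The bounds `B₁` and `B₂`
describe these two classes of fillings. -/
theorem fillingSum_eq_add_eraseCorner (w : ℕ × ℕ → ℕ → R) {μ : YoungDiagram} {c : ℕ × ℕ}
    (hc : IsCorner μ c) {n : ℕ} {B B₁ B₂ : ℕ × ℕ → ℕ} (hB : B c = n + 1)
    (h₁ : ∀ d, B₁ d ≤ B d) (h₁c : B₁ c = n)
    (h₁' : ∀ T ∈ fillings μ B, T c ≤ n → ∀ d ∈ μ, T d ≤ B₁ d)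
    (h₂ : ∀ d, B₂ d ≤ B d) (h₂left : ∀ j < c.2, B₂ (c.1, j) ≤ n + 1)
    (h₂above : ∀ i < c.1, B₂ (i, c.2) ≤ n)
    (h₂' : ∀ T ∈ fillings μ B, T c = n + 1 → ∀ d ∈ μ, d ≠ c → T d ≤ B₂ d) :
    fillingSum w μ B =
      fillingSum w μ B₁ + w c (n + 1) * fillingSum w (eraseCorner μ c hc) B₂ := by
  have hfin := fillings_finite μ B
  unfold fillingSum
  rw [← finsum_mem_inter_add_sdiff {T | T c ≤ n} hfin]
  congr 1
  · refine finsum_mem_congr (Set.ext fun T => ⟨fun h => mem_fillings_of_le h.1 (h₁' T h.1 h.2),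
      fun h => ?_⟩) fun _ _ => rfl
    exact ⟨mem_fillings_of_le h fun d hd => ((h.1 d hd).2).trans (h₁ d),
      ((h.1 c hc.1).2).trans h₁c.le⟩
  · rw [mul_finsum_mem' _ _ (fillings_finite _ _)]
    have key : ∀ T ∈ fillings μ B \ {T | T c ≤ n}, T ∈ fillings μ B ∧ T c = n + 1 := by
      rintro T ⟨hT, hTc⟩
      have := (hT.1 c hc.1).2
      simp only [Set.mem_ofPred_eq] at hTc
      exact ⟨hT, by omega⟩
    refine finsum_mem_eq_of_bijOn (fun T => Function.update T c 0) ⟨?_, ?_, ?_⟩ ?_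
    · intro T hT
      obtain ⟨hT, hTc⟩ := key T hT
      change Function.update T c 0 ∈ _
      refine ⟨fun d hd => ?_, fun d hd => ?_, fun i j₁ j₂ hj hd => ?_, fun i₁ i₂ j hi hd => ?_⟩
      · rw [mem_eraseCorner] at hd
        rw [Function.update_of_ne hd.1]
        exact ⟨(hT.1 d hd.2).1, h₂' T hT hTc d hd.2 hd.1⟩
      · rw [mem_eraseCorner] at hd
        by_cases h : d = c
        · rw [h, Function.update_self]
        · rw [Function.update_of_ne h]
          exact hT.2.1 d fun h' => hd ⟨h, h'⟩
      · have hd' := (mem_eraseCorner hc).1 hd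
        have hd₁ := (mem_eraseCorner hc).1 ((eraseCorner μ c hc).up_left_mem le_rfl hj.le hd)
        rw [Function.update_of_ne hd'.1, Function.update_of_ne hd₁.1]
        exact hT.2.2.1 i j₁ j₂ hj hd'.2
      · have hd' := (mem_eraseCorner hc).1 hd
        have hd₁ := (mem_eraseCorner hc).1 ((eraseCorner μ c hc).up_left_mem hi.le le_rfl hd)
        rw [Function.update_of_ne hd'.1, Function.update_of_ne hd₁.1]
        exact hT.2.2.2 i₁ i₂ j hi hd'.2
    · intro T hT T' hT' h
      funext d
      by_cases hd : d = c
      · rw [hd, (key T hT).2, (key T' hT').2]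
      · simpa [Function.update_of_ne hd] using congrFun h d
    · intro T hT
      refine ⟨Function.update T c (n + 1), ⟨⟨fun d hd => ?_, fun d hd => ?_,
        fun i j₁ j₂ hj hd => ?_, fun i₁ i₂ j hi hd => ?_⟩, ?_⟩, ?_⟩
      · by_cases h : d = c
        · rw [h, Function.update_self, hB]
          exact ⟨n.succ_pos, le_rfl⟩
        · rw [Function.update_of_ne h]
          have := hT.1 d ((mem_eraseCorner hc).2 ⟨h, hd⟩)
          exact ⟨this.1, this.2.trans (h₂ d)⟩
      · have h : d ≠ c := fun h => hd (h ▸ hc.1)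
        rw [Function.update_of_ne h]
        exact hT.2.1 d fun h' => hd ((mem_eraseCorner hc).1 h').2
      · have h₀ : (i, j₁) ≠ c := by
          rintro rfl
          exact hc.2.2 (μ.up_left_mem le_rfl hj hd)
        rw [Function.update_of_ne h₀]
        by_cases h : (i, j₂) = c
        · rw [h, Function.update_self]
          subst h
          exact ((hT.1 _ ((mem_eraseCorner hc).2
            ⟨h₀, μ.up_left_mem le_rfl hj.le hd⟩)).2).trans (h₂left j₁ hj)
        · rw [Function.update_of_ne h]
          exact hT.2.2.1 i j₁ j₂ hj ((mem_eraseCorner hc).2 ⟨h, hd⟩)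
      · have h₀ : (i₁, j) ≠ c := by
          rintro rfl
          exact hc.2.1 (μ.up_left_mem hi le_rfl hd)
        rw [Function.update_of_ne h₀]
        by_cases h : (i₂, j) = c
        · rw [h, Function.update_self]
          subst h
          exact Nat.lt_succ_of_le (((hT.1 _ ((mem_eraseCorner hc).2
            ⟨h₀, μ.up_left_mem hi.le le_rfl hd⟩)).2).trans (h₂above i₁ hi))
        · rw [Function.update_of_ne h]
          exact hT.2.2.2 i₁ i₂ j hi ((mem_eraseCorner hc).2 ⟨h, hd⟩)
      · simp
      · funext d
        by_cases h : d = c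
        · subst h
          simp only [Function.update_self]
          exact (hT.2.1 d fun h' => ((mem_eraseCorner hc).1 h').1 rfl).symm
        · simp [Function.update_of_ne h]
    · intro T hT
      rw [← Finset.mul_prod_erase μ.cells _ ((YoungDiagram.mem_cells c).2 hc.1), (key T hT).2]
      congr 1
      refine Finset.prod_congr rfl fun d hd => ?_
      rw [Function.update_of_ne (Finset.ne_of_mem_erase hd)]

theorem fillingSum_congr (w : ℕ × ℕ → ℕ → R) {μ : YoungDiagram} {B B' : ℕ × ℕ → ℕ}
    (h : ∀ c ∈ μ, B c = B' c) : fillingSum w μ B = fillingSum w μ B' := by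
  have : fillings μ B = fillings μ B' := Set.ext fun T =>
    ⟨fun hT => mem_fillings_of_le hT fun c hc => ((hT.1 c hc).2).trans (h c hc).le,
      fun hT => mem_fillings_of_le hT fun c hc => ((hT.1 c hc).2).trans (h c hc).ge⟩
  rw [fillingSum, this, fillingSum]

theorem fillingSum_bot (w : ℕ × ℕ → ℕ → R) (B : ℕ × ℕ → ℕ) : fillingSum w ⊥ B = 1 := by
  have : fillings ⊥ B = {0} := by
    refine Set.Subset.antisymm (fun T hT => ?_) ?_
    · exact funext fun c => hT.2.1 c (YoungDiagram.notMem_bot c)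
    · rintro _ rfl
      refine ⟨fun c hc => ?_, fun c hc => rfl, fun _ _ _ _ hc => ?_, fun _ _ _ _ hc => ?_⟩ <;>
        exact absurd hc (YoungDiagram.notMem_bot _)
  simp [fillingSum, this]

theorem fillingSum_zero (w : ℕ × ℕ → ℕ → R) {μ : YoungDiagram} (hμ : (0, 0) ∈ μ) :
    fillingSum w μ 0 = 0 := by
  have : fillings μ 0 = ∅ := Set.eq_empty_of_forall_notMem fun T hT => by
    have := hT.1 _ hμ
    simp only [Pi.zero_apply] at this
    omega
  simp [fillingSum, this]

theorem eq_bot_of_zero_notMem {μ : YoungDiagram} (hμ : (0, 0) ∉ μ) : μ = ⊥ := by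
  refine YoungDiagram.ext (Finset.eq_empty_of_forall_notMem fun c hc => hμ ?_)
  exact μ.up_left_mem (Nat.zero_le c.1) (Nat.zero_le c.2) hc

/-! ### Row and column flags -/

/-- The bound `n` on the rows above row `i`, and `n + 1` from row `i` on. -/
def rowFlag (n i : ℕ) (c : ℕ × ℕ) : ℕ := if c.1 < i then n else n + 1

/-- The bound `n + 1` on the columns to the left of column `i`, and `n` from column `i` on. -/
def colFlag (n i : ℕ) (c : ℕ × ℕ) : ℕ := if c.2 < i then n + 1 else n

theorem isCorner_of_rowLen_lt {μ : YoungDiagram} {i : ℕ} (h : μ.rowLen (i + 1) < μ.rowLen i) :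
    IsCorner μ (i, μ.rowLen i - 1) := by
  simp only [IsCorner, YoungDiagram.mem_iff_lt_rowLen]
  omega

theorem isCorner_of_colLen_lt {μ : YoungDiagram} {i : ℕ} (h : μ.colLen (i + 1) < μ.colLen i) :
    IsCorner μ (μ.colLen i - 1, i) := by
  simp only [IsCorner, YoungDiagram.mem_iff_lt_colLen]
  omega

theorem rowLen_eraseCorner {μ : YoungDiagram} {i : ℕ} (hc : IsCorner μ (i, μ.rowLen i - 1))
    (k : ℕ) : (eraseCorner μ _ hc).rowLen k = if k = i then μ.rowLen i - 1 else μ.rowLen k := by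
  refine eq_of_forall_lt_iff fun j => ?_
  rw [← YoungDiagram.mem_iff_lt_rowLen, mem_eraseCorner, YoungDiagram.mem_iff_lt_rowLen]
  split_ifs with h
  · subst h
    simp only [ne_eq, Prod.mk.injEq, true_and]
    omega
  · simp [h]

theorem colLen_eraseCorner {μ : YoungDiagram} {i : ℕ} (hc : IsCorner μ (μ.colLen i - 1, i))
    (k : ℕ) : (eraseCorner μ _ hc).colLen k = if k = i then μ.colLen i - 1 else μ.colLen k := by
  refine eq_of_forall_lt_iff fun j => ?_
  rw [← YoungDiagram.mem_iff_lt_colLen, mem_eraseCorner, YoungDiagram.mem_iff_lt_colLen]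
  split_ifs with h
  · subst h
    simp only [ne_eq, Prod.mk.injEq, and_true]
    omega
  · simp [h]

/-- If the rows `i` and `i + 1` have the same length, then lowering the bound on row `i` from
`n + 1` to `n` changes nothing, because of the boxes directly below. -/
theorem fillingSum_rowFlag_of_eq (w : ℕ × ℕ → ℕ → R) {μ : YoungDiagram} {n i : ℕ}
    (h : μ.rowLen (i + 1) = μ.rowLen i) :
    fillingSum w μ (rowFlag n i) = fillingSum w μ (rowFlag n (i + 1)) := by
  have : fillings μ (rowFlag n i) = fillings μ (rowFlag n (i + 1)) := by
    refine Set.ext fun T => ⟨fun hT => mem_fillings_of_le hT fun c hc => ?_,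
      fun hT => mem_fillings_of_le hT fun c hc => ((hT.1 c hc).2).trans ?_⟩
    · have h1 := (hT.1 c hc).2
      unfold rowFlag at h1 ⊢
      by_cases hci : c.1 = i
      · have hmem : (i + 1, c.2) ∈ μ := by
          rw [YoungDiagram.mem_iff_lt_rowLen, h, ← hci, ← YoungDiagram.mem_iff_lt_rowLen]
          exact hc
        have h2 := hT.2.2.2 i (i + 1) c.2 i.lt_succ_self hmem
        have h3 := (hT.1 _ hmem).2
        have h4 : (i, c.2) = c := by rw [← hci]
        rw [h4] at h2
        unfold rowFlag at h3
        split_ifs at * <;> omega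
      · split_ifs at * <;> omega
    · unfold rowFlag
      split_ifs <;> omega
  rw [fillingSum, this, fillingSum]

theorem fillingSum_rowFlag_of_lt (w : ℕ × ℕ → ℕ → R) {μ : YoungDiagram} {n i : ℕ}
    (h : μ.rowLen (i + 1) < μ.rowLen i) :
    fillingSum w μ (rowFlag n i) = fillingSum w μ (rowFlag n (i + 1)) +
      w (i, μ.rowLen i - 1) (n + 1) *
        fillingSum w (eraseCorner μ _ (isCorner_of_rowLen_lt h)) (rowFlag n i) := by
  refine fillingSum_eq_add_eraseCorner w (isCorner_of_rowLen_lt h) (by simp [rowFlag])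
    (fun d => ?_) (by simp [rowFlag]) (fun T hT hTc d hd => ?_) (fun d => le_rfl)
    (fun j _ => by simp [rowFlag]) (fun i' hi' => ?_) (fun T hT _ d hd _ => (hT.1 d hd).2)
  · unfold rowFlag
    split_ifs <;> omega
  · have h1 := (hT.1 d hd).2
    unfold rowFlag at h1 ⊢
    by_cases hdi : d.1 = i
    · have h4 : (i, d.2) = d := by rw [← hdi]
      have hd' : d.2 < μ.rowLen i := by
        rw [← YoungDiagram.mem_iff_lt_rowLen, h4]; exact hd
      have : T d ≤ n := by
        rcases (show d.2 ≤ μ.rowLen i - 1 by omega).lt_or_eq with h5 | h5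
        · have := hT.2.2.1 i d.2 _ h5 (isCorner_of_rowLen_lt h).1
          rw [h4] at this
          exact this.trans hTc
        · rw [← h4, h5]
          exact hTc
      split_ifs <;> omega
    · split_ifs at * <;> omega
  · have : i' < i := hi'
    simp [rowFlag, this]

/-- If the columns `i` and `i + 1` have the same length, then raising the bound on column `i` from
`n` to `n + 1` changes nothing, because of the boxes directly to the right. -/
theorem fillingSum_colFlag_of_eq (w : ℕ × ℕ → ℕ → R) {μ : YoungDiagram} {n i : ℕ}
    (h : μ.colLen (i + 1) = μ.colLen i) :
    fillingSum w μ (colFlag n (i + 1)) = fillingSum w μ (colFlag n i) := by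
  have : fillings μ (colFlag n (i + 1)) = fillings μ (colFlag n i) := by
    refine Set.ext fun T => ⟨fun hT => mem_fillings_of_le hT fun c hc => ?_,
      fun hT => mem_fillings_of_le hT fun c hc => ((hT.1 c hc).2).trans ?_⟩
    · have h1 := (hT.1 c hc).2
      unfold colFlag at h1 ⊢
      by_cases hci : c.2 = i
      · have hmem : (c.1, i + 1) ∈ μ := by
          rw [YoungDiagram.mem_iff_lt_colLen, h, ← hci, ← YoungDiagram.mem_iff_lt_colLen]
          exact hc
        have h2 := hT.2.2.1 c.1 i (i + 1) i.lt_succ_self hmem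
        have h3 := (hT.1 _ hmem).2
        have h4 : (c.1, i) = c := by rw [← hci]
        rw [h4] at h2
        unfold colFlag at h3
        split_ifs at * <;> omega
      · split_ifs at * <;> omega
    · unfold colFlag
      split_ifs <;> omega
  rw [fillingSum, this, fillingSum]

theorem fillingSum_colFlag_of_lt (w : ℕ × ℕ → ℕ → R) {μ : YoungDiagram} {n i : ℕ}
    (h : μ.colLen (i + 1) < μ.colLen i) :
    fillingSum w μ (colFlag n (i + 1)) = fillingSum w μ (colFlag n i) +
      w (μ.colLen i - 1, i) (n + 1) *
        fillingSum w (eraseCorner μ _ (isCorner_of_colLen_lt h)) (colFlag n i) := by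
  have above : ∀ T ∈ fillings μ (colFlag n (i + 1)), ∀ d ∈ μ, d ≠ (μ.colLen i - 1, i) → d.2 = i →
      T d < T (μ.colLen i - 1, i) := by
    intro T hT d hd hne hdi
    have h4 : (d.1, i) = d := by rw [← hdi]
    have hd' : d.1 < μ.colLen i := by
      rw [← YoungDiagram.mem_iff_lt_colLen, h4]; exact hd
    have h5 : d.1 ≠ μ.colLen i - 1 := fun h5 => hne (by rw [← h4, h5])
    have := hT.2.2.2 d.1 (μ.colLen i - 1) i (by omega) (isCorner_of_colLen_lt h).1
    rwa [h4] at this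
  refine fillingSum_eq_add_eraseCorner w (isCorner_of_colLen_lt h) (by simp [colFlag])
    (fun d => ?_) (by simp [colFlag]) (fun T hT hTc d hd => ?_) (fun d => ?_)
    (fun j hj => ?_) (fun i' hi' => by simp [colFlag]) (fun T hT hTc d hd hne => ?_)
  · unfold colFlag
    split_ifs <;> omega
  · have h1 := (hT.1 d hd).2
    unfold colFlag at h1 ⊢
    by_cases hdi : d.2 = i
    · have : T d ≤ n := by
        by_cases hne : d = (μ.colLen i - 1, i)
        · rw [hne]; exact hTc
        · exact ((above T hT d hd hne hdi).le).trans hTc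
      split_ifs <;> omega
    · split_ifs at * <;> omega
  · unfold colFlag
    split_ifs <;> omega
  · have : j < i := hj
    simp [colFlag, this]
  · have h1 := (hT.1 d hd).2
    unfold colFlag at h1 ⊢
    by_cases hdi : d.2 = i
    · have := above T hT d hd hne hdi
      split_ifs <;> omega
    · split_ifs at * <;> omega

/-! ### Sums over bounded monotone sequences -/

/-- The sequences of length `L` with entries in `{1, …, N}` whose entries are increasing with
respect to `r`, which will be `≤` or `<`. -/
def boundedSeqs (r : ℕ → ℕ → Prop) (L N : ℕ) : Set (Fin L → ℕ) :=
  {m | (∀ i j, i < j → r (m i) (m j)) ∧ ∀ k, 0 < m k ∧ m k ≤ N}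

theorem boundedSeqs_finite (r : ℕ → ℕ → Prop) (L N : ℕ) : (boundedSeqs r L N).Finite :=
  (Set.Finite.pi' fun _ => Set.finite_Iic N).subset fun _ hm k => (hm.2 k).2

/-- The generating function of the sequences in `boundedSeqs r L N`, where the entry `m` in position
`k` contributes the factor `y k m`. -/
noncomputable def seqSum (r : ℕ → ℕ → Prop) (y : ℕ → ℕ → R) (L N : ℕ) : R :=
  ∑ᶠ m ∈ boundedSeqs r L N, ∏ k : Fin L, y k (m k)

theorem seqSum_zero_left (r : ℕ → ℕ → Prop) (y : ℕ → ℕ → R) (N : ℕ) : seqSum r y 0 N = 1 := by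
  have : boundedSeqs r 0 N = {Fin.elim0} := Set.ext fun m =>
    ⟨fun _ => Subsingleton.elim _ _, fun _ => ⟨fun i => i.elim0, fun i => i.elim0⟩⟩
  simp [seqSum, this]

theorem seqSum_succ_zero (r : ℕ → ℕ → Prop) (y : ℕ → ℕ → R) (L : ℕ) :
    seqSum r y (L + 1) 0 = 0 := by
  have : boundedSeqs r (L + 1) 0 = ∅ := Set.eq_empty_of_forall_notMem fun m hm => by
    have := hm.2 0
    omega
  simp [seqSum, this]

/-- The last entry of a sequence bounded by `N + 1` is either at most `N` or equal to `N + 1`; in the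
second case the entries before it are bounded by `N'`, which is `N + 1` for `≤` and `N` for `<`. -/
theorem seqSum_succ_succ {r : ℕ → ℕ → Prop} (hr : ∀ a b, r a b → a ≤ b) (y : ℕ → ℕ → R)
    (L : ℕ) {N N' : ℕ} (hN : ∀ a, r a (N + 1) ↔ a ≤ N') (hN' : N' ≤ N + 1) :
    seqSum r y (L + 1) (N + 1) = seqSum r y (L + 1) N + y L (N + 1) * seqSum r y L N' := by
  have hfin := boundedSeqs_finite r (L + 1) (N + 1)
  unfold seqSum
  rw [← finsum_mem_inter_add_sdiff {m | m (Fin.last L) ≤ N} hfin]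
  congr 1
  · refine finsum_mem_congr (Set.ext fun m => ⟨fun h => ⟨h.1.1, fun k => ⟨(h.1.2 k).1, ?_⟩⟩,
      fun h => ⟨⟨h.1, fun k => ⟨(h.2 k).1, (h.2 k).2.trans N.le_succ⟩⟩, (h.2 _).2⟩⟩)
      fun _ _ => rfl
    rcases (Fin.le_last k).lt_or_eq with hk | hk
    · exact (hr _ _ (h.1.1 k _ hk)).trans h.2
    · rw [hk]
      exact h.2
  · rw [mul_finsum_mem' _ _ (boundedSeqs_finite _ _ _)]
    have key : ∀ m ∈ boundedSeqs r (L + 1) (N + 1) \ {m | m (Fin.last L) ≤ N},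
        m ∈ boundedSeqs r (L + 1) (N + 1) ∧ m (Fin.last L) = N + 1 := by
      rintro m ⟨hm, hl⟩
      have := (hm.2 (Fin.last L)).2
      simp only [Set.mem_ofPred_eq] at hl
      exact ⟨hm, by omega⟩
    refine finsum_mem_eq_of_bijOn (fun m (k : Fin L) => m k.castSucc) ⟨?_, ?_, ?_⟩ ?_
    · intro m hm
      obtain ⟨hm, hl⟩ := key m hm
      refine ⟨fun i j hij => hm.1 _ _ (Fin.castSucc_lt_castSucc_iff.2 hij), fun k =>
        ⟨(hm.2 _).1, ?_⟩⟩
      have := hm.1 k.castSucc (Fin.last L) (Fin.castSucc_lt_last k)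
      rw [hl] at this
      exact (hN _).1 this
    · intro m hm m' hm' h
      funext k
      refine Fin.lastCases ?_ (fun k => ?_) k
      · rw [(key m hm).2, (key m' hm').2]
      · exact congrFun h k
    · intro m hm
      refine ⟨Fin.snoc (α := fun _ => ℕ) m (N + 1), ⟨⟨fun i j hij => ?_, fun k => ?_⟩, ?_⟩, ?_⟩
      · obtain ⟨i, rfl⟩ := Fin.exists_castSucc_eq.2 (hij.trans_le (Fin.le_last j)).ne
        rw [Fin.snoc_castSucc]
        revert hij
        refine Fin.lastCases (fun _ => ?_) (fun j hij => ?_) j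
        · rw [Fin.snoc_last]
          exact (hN _).2 (hm.2 i).2
        · rw [Fin.snoc_castSucc]
          exact hm.1 i j (Fin.castSucc_lt_castSucc_iff.1 hij)
      · refine Fin.lastCases ?_ (fun k => ?_) k
        · rw [Fin.snoc_last]
          exact ⟨N.succ_pos, le_rfl⟩
        · rw [Fin.snoc_castSucc]
          exact ⟨(hm.2 k).1, (hm.2 k).2.trans hN'⟩
      · simp
      · funext k
        simp
    · intro m hm
      rw [Fin.prod_univ_castSucc, (key m hm).2, mul_comm]
      simp

/-- `seqSum` with an integral length, with value `0` for negative lengths. -/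
noncomputable def seqSumInt (r : ℕ → ℕ → Prop) (y : ℕ → ℕ → R) (L : ℤ) (N : ℕ) : R :=
  if L < 0 then 0 else seqSum r y L.toNat N

theorem seqSumInt_of_neg (r : ℕ → ℕ → Prop) (y : ℕ → ℕ → R) {L : ℤ} (hL : L < 0) (N : ℕ) :
    seqSumInt r y L N = 0 := if_pos hL

theorem seqSumInt_natCast (r : ℕ → ℕ → Prop) (y : ℕ → ℕ → R) (L N : ℕ) :
    seqSumInt r y L N = seqSum r y L N := by
  simp [seqSumInt]

theorem seqSumInt_zero_right (r : ℕ → ℕ → Prop) (y : ℕ → ℕ → R) (L : ℤ) :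
    seqSumInt r y L 0 = if L = 0 then 1 else 0 := by
  rcases lt_or_ge L 0 with hL | hL
  · rw [seqSumInt_of_neg r y hL, if_neg hL.ne]
  · lift L to ℕ using hL
    rw [seqSumInt_natCast]
    cases L with
    | zero => rw [seqSum_zero_left]; simp
    | succ L => rw [seqSum_succ_zero, if_neg (by positivity)]

theorem seqSumInt_succ {r : ℕ → ℕ → Prop} (hr : ∀ a b, r a b → a ≤ b) (y : ℕ → ℕ → R)
    (L : ℤ) {N N' : ℕ} (hN : ∀ a, r a (N + 1) ↔ a ≤ N') (hN' : N' ≤ N + 1) {z : R}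
    (hz : ∀ k : ℕ, L = k + 1 → y k (N + 1) = z) :
    seqSumInt r y L (N + 1) = seqSumInt r y L N + z * seqSumInt r y (L - 1) N' := by
  rcases lt_or_ge L 0 with hL | hL
  · simp [seqSumInt_of_neg, hL, (sub_one_lt L).trans hL]
  · lift L to ℕ using hL
    cases L with
    | zero => simp [seqSumInt, seqSum_zero_left]
    | succ L =>
      rw [seqSumInt_natCast, seqSumInt_natCast, seqSum_succ_succ hr y L hN hN',
        hz L (by push_cast; rfl), show (((L + 1 : ℕ) : ℤ) - 1) = (L : ℕ) by push_cast; ring,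
        seqSumInt_natCast]

/-! ### Jacobi–Trudi determinants with flags -/

/-- The Jacobi–Trudi matrix for rows of lengths `len i`, where the sequences in row `i` are bounded
by `lev i` and where `x c m` is the weight of the entry `m` at content `c`. For the `E`-type formula,
it is used with `<` for `r`, with the column lengths, and with the signs of all contents
reversed. -/
noncomputable def jacobiTrudi {d : ℕ} (r : ℕ → ℕ → Prop) (x : ℤ → ℕ → R) (lev : Fin d → ℕ)
    (len : Fin d → ℤ) : Matrix (Fin d) (Fin d) R :=
  Matrix.of fun i j =>
    seqSumInt r (fun k m => x (-((j : ℕ) : ℤ) + (k : ℤ)) m) (len i - ((i : ℕ) : ℤ) + ((j : ℕ) : ℤ))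
      (lev i)

/-- The recursion of `seqSum`, applied to a single row by multilinearity. -/
theorem det_jacobiTrudi_succ {d : ℕ} {r : ℕ → ℕ → Prop} (hr : ∀ a b, r a b → a ≤ b)
    (x : ℤ → ℕ → R) (lev : Fin d → ℕ) (len : Fin d → ℤ) (i : Fin d) {n n' : ℕ}
    (hn : ∀ a, r a (n + 1) ↔ a ≤ n') (hn' : n' ≤ n + 1) (hi : lev i = n + 1) :
    (jacobiTrudi r x lev len).det =
      (jacobiTrudi r x (Function.update lev i n) len).det +
        x (len i - ((i : ℕ) : ℤ) - 1) (n + 1) *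
          (jacobiTrudi r x (Function.update lev i n') (Function.update len i (len i - 1))).det := by
  have h₀ : jacobiTrudi r x lev len =
      (jacobiTrudi r x lev len).updateRow i
        ((jacobiTrudi r x (Function.update lev i n) len) i +
          x (len i - ((i : ℕ) : ℤ) - 1) (n + 1) •
            (jacobiTrudi r x (Function.update lev i n') (Function.update len i (len i - 1))) i) := by
    ext i' j
    by_cases h : i' = i
    · subst h
      rw [Matrix.updateRow_self]
      simp only [jacobiTrudi, Matrix.of_apply, Pi.add_apply, Pi.smul_apply, Function.update_self,
        smul_eq_mul, hi]
      rw [seqSumInt_succ hr _ _ hn hn' (z := x (len i' - ((i' : ℕ) : ℤ) - 1) (n + 1))]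
      · congr 3
        ring
      · intro k hk
        congr 1
        linarith
    · rw [Matrix.updateRow_ne h]
  rw [h₀, Matrix.det_updateRow_add, Matrix.det_updateRow_smul]
  congr 3
  · ext i' j
    by_cases h : i' = i
    · subst h
      rw [Matrix.updateRow_self]
    · rw [Matrix.updateRow_ne h]
      simp [jacobiTrudi, Function.update_of_ne h]
  · ext i' j
    by_cases h : i' = i
    · subst h
      rw [Matrix.updateRow_self]
    · rw [Matrix.updateRow_ne h]
      simp [jacobiTrudi, Function.update_of_ne h]

/-- Shortening a row whose successor has the same length (where the successor of the last row counts
as empty) produces two equal rows or a zero row. -/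
theorem det_jacobiTrudi_eq_zero {d : ℕ} (r : ℕ → ℕ → Prop) (x : ℤ → ℕ → R) (lev : Fin d → ℕ)
    (len : ℕ → ℤ) (hlen : len d = 0) (i : Fin d) (h : len (i + 1) = len i)
    (hlev : ∀ i' : Fin d, (i' : ℕ) = i + 1 → lev i' = lev i) :
    (jacobiTrudi r x lev (Function.update (fun k => len k) i (len i - 1))).det = 0 := by
  by_cases hi : (i : ℕ) + 1 < d
  · have hne : (⟨i + 1, hi⟩ : Fin d) ≠ i := fun h => by simpa using congrArg Fin.val h
    refine Matrix.det_zero_of_row_eq hne ?_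
    ext j
    simp only [jacobiTrudi, Matrix.of_apply, Function.update_self, Function.update_of_ne hne, h,
      hlev ⟨i + 1, hi⟩ rfl]
    congr 1
    push_cast
    ring
  · have hid : (i : ℕ) + 1 = d := by omega
    rw [hid, hlen] at h
    refine Matrix.det_eq_zero_of_row_eq_zero i fun j => ?_
    simp only [jacobiTrudi, Matrix.of_apply, Function.update_self]
    exact seqSumInt_of_neg _ _ (by omega) _

theorem det_jacobiTrudi_bot {d : ℕ} (r : ℕ → ℕ → Prop) (x : ℤ → ℕ → R) :
    (jacobiTrudi (d := d) r x 0 0).det = 1 := by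
  have : jacobiTrudi (d := d) r x 0 0 = 1 := by
    ext i j
    simp only [jacobiTrudi, Matrix.of_apply, Pi.zero_apply, seqSumInt_zero_right, Matrix.one_apply,
      Fin.ext_iff]
    congr 1
    refine propext ⟨fun h => ?_, fun h => ?_⟩ <;> omega
  rw [this, Matrix.det_one]

theorem det_jacobiTrudi_zero {d : ℕ} (r : ℕ → ℕ → Prop) (x : ℤ → ℕ → R) (len : ℕ → ℤ)
    (hd : 0 < d) (h : 0 < len 0) : (jacobiTrudi (d := d) r x 0 fun k => len k).det = 0 := by
  refine Matrix.det_eq_zero_of_row_eq_zero ⟨0, hd⟩ fun j => ?_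
  simp only [jacobiTrudi, Matrix.of_apply, Pi.zero_apply, seqSumInt_zero_right]
  rw [if_neg]
  push_cast
  omega

/-! ### The Jacobi–Trudi formulas for bounded tableaux -/

theorem rowLen_eq_zero_of_le {μ : YoungDiagram} {d : ℕ} (hd : μ.colLen 0 ≤ d) :
    μ.rowLen d = 0 := by
  by_contra h
  have := YoungDiagram.mem_iff_lt_colLen.1 (YoungDiagram.mem_iff_lt_rowLen.2 (Nat.pos_of_ne_zero h))
  omega

theorem colLen_eq_zero_of_le {μ : YoungDiagram} {d : ℕ} (hd : μ.rowLen 0 ≤ d) :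
    μ.colLen d = 0 := by
  by_contra h
  have := YoungDiagram.mem_iff_lt_rowLen.1 (YoungDiagram.mem_iff_lt_colLen.2 (Nat.pos_of_ne_zero h))
  omega

theorem colLen_eraseCorner_le {μ : YoungDiagram} {c : ℕ × ℕ} (hc : IsCorner μ c) (k : ℕ) :
    (eraseCorner μ c hc).colLen k ≤ μ.colLen k := by
  refine le_of_forall_lt fun i hi => ?_
  rw [← YoungDiagram.mem_iff_lt_colLen] at hi ⊢
  exact ((mem_eraseCorner hc).1 hi).2

theorem rowLen_eraseCorner_le {μ : YoungDiagram} {c : ℕ × ℕ} (hc : IsCorner μ c) (k : ℕ) :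
    (eraseCorner μ c hc).rowLen k ≤ μ.rowLen k := by
  refine le_of_forall_lt fun i hi => ?_
  rw [← YoungDiagram.mem_iff_lt_rowLen] at hi ⊢
  exact ((mem_eraseCorner hc).1 hi).2

theorem card_eraseCorner_lt {μ : YoungDiagram} {c : ℕ × ℕ} (hc : IsCorner μ c) :
    (eraseCorner μ c hc).card < μ.card :=
  Finset.card_erase_lt_of_mem ((YoungDiagram.mem_cells c).2 hc.1)

/-- The `H`-type formula when the first `i` rows are bounded by `n` and the others by `n + 1`, given
the formula for the uniform bound `n`. Each step raises the bound of one more row. -/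
theorem fillingSum_rowFlag_eq_det (x : ℤ → ℕ → R) (d n : ℕ)
    (ih : ∀ μ : YoungDiagram, μ.colLen 0 ≤ d →
      fillingSum (fun c m => x ((c.2 : ℤ) - (c.1 : ℤ)) m) μ (fun _ => n) =
        (jacobiTrudi (d := d) (· ≤ ·) x (fun _ => n) fun k => (μ.rowLen k : ℤ)).det)
    (t i : ℕ) (hti : i + t = d) (μ : YoungDiagram) (hμ : μ.colLen 0 ≤ d) :
    fillingSum (fun c m => x ((c.2 : ℤ) - (c.1 : ℤ)) m) μ (rowFlag n i) =
      (jacobiTrudi (d := d) (· ≤ ·) x (fun k => if (k : ℕ) < i then n else n + 1)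
        fun k => (μ.rowLen k : ℤ)).det := by
  induction t generalizing i μ with
  | zero =>
    obtain rfl : i = d := by simpa using hti
    rw [fillingSum_congr _ (B' := fun _ => n), ih μ hμ]
    · congr 2
      funext k
      rw [if_pos k.2]
    · intro c hc
      refine if_pos (lt_of_lt_of_le ?_ hμ)
      rw [← YoungDiagram.mem_iff_lt_colLen]
      exact μ.up_left_mem le_rfl (Nat.zero_le _) hc
  | succ t iht =>
    have hid : i < d := by omega
    obtain ⟨N, hN⟩ : ∃ N, μ.card = N := ⟨_, rfl⟩
    induction N using Nat.strong_induction_on generalizing μ with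
    | _ N ihN =>
    rw [det_jacobiTrudi_succ (fun _ _ h => h) x _ _ ⟨i, hid⟩ (n := n) (n' := n + 1)
      (fun _ => Iff.rfl) le_rfl (by simp)]
    have hlev : Function.update (fun k : Fin d => if (k : ℕ) < i then n else n + 1) ⟨i, hid⟩ n =
        fun k : Fin d => if (k : ℕ) < i + 1 then n else n + 1 := by
      funext k
      by_cases h : k = ⟨i, hid⟩
      · simp [h]
      · have : (k : ℕ) ≠ i := fun h' => h (Fin.ext h')
        rw [Function.update_of_ne h]
        congr 1
        refine propext ⟨fun h => ?_, fun h => ?_⟩ <;> omega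
    have hlev' : Function.update (fun k : Fin d => if (k : ℕ) < i then n else n + 1) ⟨i, hid⟩
        (n + 1) = fun k : Fin d => if (k : ℕ) < i then n else n + 1 := by
      rw [Function.update_eq_self_iff]
      simp
    rw [hlev, hlev', ← iht (i + 1) (by omega) μ hμ]
    rcases (μ.rowLen_anti i (i + 1) i.le_succ).lt_or_eq with h | h
    · rw [fillingSum_rowFlag_of_lt _ h]
      have hc := isCorner_of_rowLen_lt h
      have hpos : 0 < μ.rowLen i := by omega
      rw [ihN _ (hN ▸ card_eraseCorner_lt hc) _ ((colLen_eraseCorner_le hc 0).trans hμ) rfl]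
      congr 2
      · congr 1
        simp only
        omega
      · congr 2
        funext k
        rw [rowLen_eraseCorner]
        by_cases hk : k = ⟨i, hid⟩
        · subst hk
          rw [Function.update_self]
          simp only [if_true]
          omega
        · have : (k : ℕ) ≠ i := fun h' => hk (Fin.ext h')
          rw [Function.update_of_ne hk, if_neg this]
    · rw [fillingSum_rowFlag_of_eq _ h]
      rw [det_jacobiTrudi_eq_zero _ x _ (fun k => (μ.rowLen k : ℤ))
        (by simp [rowLen_eq_zero_of_le hμ]) ⟨i, hid⟩ (by simp [h]) (fun k hk => ?_)]
      · ring
      · simp only at hk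
        simp [hk]

/-- The Jacobi–Trudi formula of `H`-type for tableaux with entries at most `n`. -/
theorem fillingSum_eq_det_rowLen (x : ℤ → ℕ → R) (d n : ℕ) (μ : YoungDiagram)
    (hμ : μ.colLen 0 ≤ d) :
    fillingSum (fun c m => x ((c.2 : ℤ) - (c.1 : ℤ)) m) μ (fun _ => n) =
      (jacobiTrudi (d := d) (· ≤ ·) x (fun _ => n) fun k => (μ.rowLen k : ℤ)).det := by
  induction n generalizing μ with
  | zero =>
    by_cases h : (0, 0) ∈ μ
    · have h₁ := YoungDiagram.mem_iff_lt_colLen.1 h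
      have h₂ := YoungDiagram.mem_iff_lt_rowLen.1 h
      exact (fillingSum_zero _ h).trans (det_jacobiTrudi_zero _ x (fun k => (μ.rowLen k : ℤ))
        (by omega) (by exact_mod_cast h₂)).symm
    · obtain rfl := eq_bot_of_zero_notMem h
      rw [fillingSum_bot]
      have : ∀ k, (⊥ : YoungDiagram).rowLen k = 0 := fun k => by
        by_contra hk
        exact YoungDiagram.notMem_bot _ (YoungDiagram.mem_iff_lt_rowLen.2 (Nat.pos_of_ne_zero hk))
      simp only [this]
      exact (det_jacobiTrudi_bot _ x).symm
  | succ n ih =>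
    rw [fillingSum_congr _ (B' := rowFlag n 0) (by simp [rowFlag]),
      fillingSum_rowFlag_eq_det x d n ih d 0 (by simp) μ hμ]
    simp

/-- The `E`-type formula when the first `i` columns are bounded by `n + 1` and the others by `n`,
given the formula for the uniform bound `n`. Each step raises the bound of one more column. -/
theorem fillingSum_colFlag_eq_det (x : ℤ → ℕ → R) (d n : ℕ)
    (ih : ∀ μ : YoungDiagram, μ.rowLen 0 ≤ d →
      fillingSum (fun c m => x ((c.1 : ℤ) - (c.2 : ℤ)) m) μ (fun _ => n) =
        (jacobiTrudi (d := d) (· < ·) x (fun _ => n) fun k => (μ.colLen k : ℤ)).det)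
    (i : ℕ) (hid : i ≤ d) (μ : YoungDiagram) (hμ : μ.rowLen 0 ≤ d) :
    fillingSum (fun c m => x ((c.1 : ℤ) - (c.2 : ℤ)) m) μ (colFlag n i) =
      (jacobiTrudi (d := d) (· < ·) x (fun k => if (k : ℕ) < i then n + 1 else n)
        fun k => (μ.colLen k : ℤ)).det := by
  induction i generalizing μ with
  | zero =>
    rw [fillingSum_congr _ (B' := fun _ => n) (by simp [colFlag]), ih μ hμ]
    simp
  | succ i ihi =>
    have hlev : Function.update (fun k : Fin d => if (k : ℕ) < i + 1 then n + 1 else n) ⟨i, hid⟩ n =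
        fun k : Fin d => if (k : ℕ) < i then n + 1 else n := by
      funext k
      by_cases h : k = ⟨i, hid⟩
      · simp [h]
      · have : (k : ℕ) ≠ i := fun h' => h (Fin.ext h')
        rw [Function.update_of_ne h]
        congr 1
        refine propext ⟨fun h => ?_, fun h => ?_⟩ <;> omega
    rw [det_jacobiTrudi_succ (fun _ _ h => h.le) x _ _ ⟨i, hid⟩ (n := n) (n' := n)
      (fun _ => Nat.lt_succ_iff) n.le_succ (by simp), hlev, ← ihi (by omega) μ hμ]
    rcases (μ.colLen_anti i (i + 1) i.le_succ).lt_or_eq with h | h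
    · rw [fillingSum_colFlag_of_lt _ h]
      have hc := isCorner_of_colLen_lt h
      have hpos : 0 < μ.colLen i := by omega
      rw [ihi (by omega) _ ((rowLen_eraseCorner_le hc 0).trans hμ)]
      congr 2
      · congr 1
        simp only
        omega
      · congr 2
        funext k
        rw [colLen_eraseCorner]
        by_cases hk : k = ⟨i, hid⟩
        · subst hk
          rw [Function.update_self]
          simp only [if_true]
          omega
        · have : (k : ℕ) ≠ i := fun h' => hk (Fin.ext h')
          rw [Function.update_of_ne hk, if_neg this]
    · rw [fillingSum_colFlag_of_eq _ h]
      rw [det_jacobiTrudi_eq_zero _ x _ (fun k => (μ.colLen k : ℤ))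
        (by simp [colLen_eq_zero_of_le hμ]) ⟨i, hid⟩ (by simp [h]) (fun k hk => ?_)]
      · ring
      · simp only at hk
        simp [hk]

/-- The Jacobi–Trudi formula of `E`-type for tableaux with entries at most `n`. Here `x` is indexed
by row minus column. -/
theorem fillingSum_eq_det_colLen (x : ℤ → ℕ → R) (d n : ℕ) (μ : YoungDiagram)
    (hμ : μ.rowLen 0 ≤ d) :
    fillingSum (fun c m => x ((c.1 : ℤ) - (c.2 : ℤ)) m) μ (fun _ => n) =
      (jacobiTrudi (d := d) (· < ·) x (fun _ => n) fun k => (μ.colLen k : ℤ)).det := by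
  induction n generalizing μ with
  | zero =>
    by_cases h : (0, 0) ∈ μ
    · have h₁ := YoungDiagram.mem_iff_lt_colLen.1 h
      have h₂ := YoungDiagram.mem_iff_lt_rowLen.1 h
      exact (fillingSum_zero _ h).trans (det_jacobiTrudi_zero _ x (fun k => (μ.colLen k : ℤ))
        (by omega) (by exact_mod_cast h₁)).symm
    · obtain rfl := eq_bot_of_zero_notMem h
      rw [fillingSum_bot]
      have : ∀ k, (⊥ : YoungDiagram).colLen k = 0 := fun k => by
        by_contra hk
        exact YoungDiagram.notMem_bot _ (YoungDiagram.mem_iff_lt_colLen.2 (Nat.pos_of_ne_zero hk))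
      simp only [this]
      exact (det_jacobiTrudi_bot _ x).symm
  | succ n ih =>
    rw [fillingSum_congr _ (B' := colFlag n d), fillingSum_colFlag_eq_det x d n ih d le_rfl μ hμ]
    · congr 2
      funext k
      rw [if_pos k.2]
    · intro c hc
      refine (if_pos (lt_of_lt_of_le ?_ hμ)).symm
      rw [← YoungDiagram.mem_iff_lt_rowLen]
      exact μ.up_left_mem (Nat.zero_le _) le_rfl hc

/-! ### Absolute convergence -/

theorem summable_pi_prod {ι : Type*} [Fintype ι] {g : ℕ → ℝ} (hg : Summable g)
    (hg₀ : ∀ m, 0 ≤ g m) : Summable fun m : ι → ℕ => ∏ k, g (m k) := by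
  classical
  refine summable_of_sum_le (c := ∏ _k : ι, ∑' m, g m)
    (fun m => Finset.prod_nonneg fun k _ => hg₀ _) fun u => ?_
  have hu : u ⊆ Fintype.piFinset fun k => u.image fun m => m k := fun m hm =>
    Fintype.mem_piFinset.2 fun k => Finset.mem_image_of_mem _ hm
  calc ∑ m ∈ u, ∏ k, g (m k)
      ≤ ∑ m ∈ Fintype.piFinset fun k => u.image fun m => m k, ∏ k, g (m k) :=
        Finset.sum_le_sum_of_subset_of_nonneg hu fun m _ _ =>
          Finset.prod_nonneg fun k _ => hg₀ _
    _ = ∏ k, ∑ j ∈ u.image fun m => m k, g j := (Finset.prod_univ_sum _ _).symm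
    _ ≤ ∏ _k : ι, ∑' m, g m :=
        Finset.prod_le_prod (fun k _ => Finset.sum_nonneg fun j _ => hg₀ j) fun k _ =>
          hg.sum_le_tsum _ fun j _ => hg₀ j

/-- If every entry is dominated by an entry at a position in `C`, then an exponent gain `ε` at the
positions in `C` can be spread out as a gain `δ` at all positions. -/
theorem prod_rpow_one_add_le {ι : Type*} [Fintype ι] [DecidableEq ι] (C : Finset ι) (m : ι → ℕ)
    (hm : ∀ k, 0 < m k) (hC : ∀ k, ∃ c ∈ C, m k ≤ m c) {δ ε : ℝ} (hδ : 0 ≤ δ)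
    (hδε : δ * Fintype.card ι ≤ ε) (σ : ι → ℝ) (hσ : ∀ k, 1 ≤ σ k)
    (hσC : ∀ c ∈ C, 1 + ε ≤ σ c) :
    ∏ k, (m k : ℝ) ^ (1 + δ) ≤ ∏ k, (m k : ℝ) ^ σ k := by
  have hm1 : ∀ k, (1 : ℝ) ≤ m k := fun k => by exact_mod_cast hm k
  have hm0 : ∀ k, (0 : ℝ) < m k := fun k => by exact_mod_cast hm k
  set P : ℝ := ∏ c ∈ C, (m c : ℝ) with hP
  have hP1 : 1 ≤ P := Finset.one_le_prod fun k _ => hm1 k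
  have hP0 : 0 < P := zero_lt_one.trans_le hP1
  have hmP : ∀ k, (m k : ℝ) ≤ P := fun k => by
    obtain ⟨c, hc, hkc⟩ := hC k
    have h1 : (m k : ℝ) ≤ m c := by exact_mod_cast hkc
    refine h1.trans ?_
    rw [hP, ← Finset.mul_prod_erase C _ hc]
    exact le_mul_of_one_le_right (hm0 c).le (Finset.one_le_prod fun k _ => hm1 k)
  have h₁ : ∏ k, (m k : ℝ) ^ δ ≤ P ^ ε :=
    calc ∏ k, (m k : ℝ) ^ δ ≤ ∏ _k : ι, P ^ δ :=
          Finset.prod_le_prod (fun k _ => Real.rpow_nonneg (hm0 k).le _) fun k _ =>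
            Real.rpow_le_rpow (hm0 k).le (hmP k) hδ
      _ = P ^ (δ * Fintype.card ι) := by
          rw [Finset.prod_const, Finset.card_univ, ← Real.rpow_natCast, ← Real.rpow_mul hP0.le]
      _ ≤ P ^ ε := Real.rpow_le_rpow_of_exponent_le hP1 hδε
  calc ∏ k, (m k : ℝ) ^ (1 + δ) = (∏ k, (m k : ℝ)) * ∏ k, (m k : ℝ) ^ δ := by
        rw [← Finset.prod_mul_distrib]
        exact Finset.prod_congr rfl fun k _ => by rw [Real.rpow_add (hm0 k), Real.rpow_one]
    _ ≤ (∏ k, (m k : ℝ)) * P ^ ε :=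
        mul_le_mul_of_nonneg_left h₁ (Finset.prod_nonneg fun k _ => (hm0 k).le)
    _ = ∏ k, ((m k : ℝ) * if k ∈ C then (m k : ℝ) ^ ε else 1) := by
        rw [Finset.prod_mul_distrib, Finset.prod_ite_mem, Finset.univ_inter, hP,
          Real.finsetProd_rpow _ _ fun k _ => (hm0 k).le]
    _ ≤ ∏ k, (m k : ℝ) ^ σ k := by
        refine Finset.prod_le_prod (fun k _ => ?_) fun k _ => ?_
        · split_ifs
          · exact mul_nonneg (hm0 k).le (Real.rpow_nonneg (hm0 k).le _)
          · exact mul_nonneg (hm0 k).le zero_le_one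
        · split_ifs with hk
          · calc (m k : ℝ) * (m k : ℝ) ^ ε = (m k : ℝ) ^ (1 + ε) := by
                  rw [Real.rpow_add (hm0 k), Real.rpow_one]
              _ ≤ _ := Real.rpow_le_rpow_of_exponent_le (hm1 k) (hσC k hk)
          · calc (m k : ℝ) * 1 = (m k : ℝ) ^ (1 : ℝ) := by rw [mul_one, Real.rpow_one]
              _ ≤ _ := Real.rpow_le_rpow_of_exponent_le (hm1 k) (hσ k)

/-- Convergence of a multiple Dirichlet series over families of positive integers in which every
entry is dominated by an entry at one of the positions in `C`: it suffices that all exponents have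
real part at least `1`, and greater than `1` at the positions in `C`. -/
theorem summable_of_dominated {ι α : Type*} [Fintype ι] (e : α → ι → ℕ)
    (he : Function.Injective e) (hpos : ∀ x k, 0 < e x k) (C : Finset ι)
    (hC : ∀ x k, ∃ c ∈ C, e x k ≤ e x c) (σ : ι → ℂ) (hσ : ∀ k, 1 ≤ (σ k).re)
    (hσC : ∀ c ∈ C, 1 < (σ c).re) :
    Summable fun x => 1 / ∏ k, (e x k : ℂ) ^ σ k := by
  classical
  obtain ⟨ε, hε, hεC⟩ : ∃ ε : ℝ, 0 < ε ∧ ∀ c ∈ C, 1 + ε ≤ (σ c).re := by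
    rcases C.eq_empty_or_nonempty with rfl | hne
    · exact ⟨1, one_pos, by simp⟩
    · obtain ⟨c, hc, hmin⟩ := C.exists_min_image (fun c => (σ c).re) hne
      exact ⟨(σ c).re - 1, sub_pos.2 (hσC c hc), fun d hd => by linarith [hmin d hd]⟩
  set δ : ℝ := ε / (Fintype.card ι + 1) with hδ
  have hδ0 : 0 < δ := by positivity
  have hδε : δ * Fintype.card ι ≤ ε := by
    rw [hδ, div_mul_eq_mul_div, div_le_iff₀ (by positivity)]
    nlinarith
  have hsum : Summable fun m : ι → ℕ => ∏ k, ((m k : ℝ) ^ (1 + δ))⁻¹ :=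
    summable_pi_prod (g := fun n : ℕ => ((n : ℝ) ^ (1 + δ))⁻¹)
      (Real.summable_nat_rpow_inv.2 (lt_add_of_pos_right 1 hδ0))
      fun m => inv_nonneg.2 (Real.rpow_nonneg m.cast_nonneg _)
  refine Summable.of_norm_bounded (hsum.comp_injective he) fun x => ?_
  have h := prod_rpow_one_add_le C (e x) (hpos x) (hC x) hδ0.le hδε (fun k => (σ k).re) hσ hεC
  have h₁ : ‖1 / ∏ k, (e x k : ℂ) ^ σ k‖ = (∏ k, (e x k : ℝ) ^ (σ k).re)⁻¹ := by
    rw [norm_div, norm_one, one_div, norm_prod]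
    congr 1
    exact Finset.prod_congr rfl fun k _ => Complex.norm_natCast_cpow_of_pos (hpos x k) _
  have h₂ : ∏ k, ((e x k : ℝ) ^ (1 + δ))⁻¹ = (∏ k, (e x k : ℝ) ^ (1 + δ))⁻¹ :=
    Finset.prod_inv_distrib _
  rw [h₁]
  refine (inv_anti₀ (Finset.prod_pos fun k _ => Real.rpow_pos_of_pos ?_ _) h).trans h₂.ge
  exact Nat.cast_pos.2 (hpos x k)

theorem exists_corner_le {μ : YoungDiagram} {c : ℕ × ℕ} (hc : c ∈ μ) :
    ∃ d, IsCorner μ d ∧ c.1 ≤ d.1 ∧ c.2 ≤ d.2 := by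
  obtain ⟨i, j⟩ := c
  have h₁ := YoungDiagram.mem_iff_lt_colLen.1 hc
  have hi : (μ.colLen j - 1, j) ∈ μ := by
    rw [YoungDiagram.mem_iff_lt_colLen]
    omega
  have h₂ := YoungDiagram.mem_iff_lt_rowLen.1 hi
  refine ⟨(μ.colLen j - 1, μ.rowLen (μ.colLen j - 1) - 1), ⟨?_, fun h => ?_, ?_⟩, ?_, ?_⟩
  · exact YoungDiagram.mem_iff_lt_rowLen.2 (by omega)
  · have := YoungDiagram.mem_iff_lt_colLen.1
      (μ.up_left_mem (i2 := μ.colLen j - 1 + 1) (j1 := j) le_rfl (by omega) h)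
    omega
  · intro h
    have : _ < μ.rowLen (μ.colLen j - 1) := YoungDiagram.mem_iff_lt_rowLen.1 h
    omega
  · simp only
    omega
  · simp only
    omega

theorem summable_schurTerm {μ : YoungDiagram} {s : Tableau μ ℂ} (hs : s ∈ region μ) :
    Summable fun M : SSYT μ => schurTerm s M := by
  classical
  refine summable_of_dominated (fun (M : SSYT μ) (c : μ.cells) => M.1 c.1.1 c.1.2) ?_
    (fun M c => M.2 _ _ c.2) (Finset.univ.filter fun c : μ.cells => IsCorner μ c.1) ?_ s ?_ ?_
  · intro M M' h
    refine Subtype.ext (SemistandardYoungTableau.ext fun i j => ?_)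
    by_cases hij : (i, j) ∈ μ
    · exact congrFun h ⟨(i, j), hij⟩
    · rw [M.1.zeros hij, M'.1.zeros hij]
  · intro M c
    obtain ⟨d, hd, h₁, h₂⟩ := exists_corner_le (c := c.1) c.2
    refine ⟨⟨d, hd.1⟩, by simpa using hd, ?_⟩
    exact (M.1.row_weak_of_le h₂ (μ.up_left_mem h₁ le_rfl hd.1)).trans (M.1.col_weak h₁ hd.1)
  · intro c
    by_cases hc : IsCorner μ c.1
    · exact ((hs c).2 hc).le
    · exact (hs c).1 hc
  · intro c hc
    exact (hs c).2 (Finset.mem_filter.1 hc).2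

/-- Convergence of the series over monotone sequences, where only the last exponent needs a real
part greater than `1`. -/
theorem summable_seqTerm {n : ℕ} {α : Type*} (e : α → Fin n → ℕ) (he : Function.Injective e)
    (hmono : ∀ x, Monotone (e x)) (hpos : ∀ x k, 0 < e x k) (σ : Fin n → ℂ)
    (hσ : ∀ k, 1 ≤ (σ k).re) (hlast : ∀ k : Fin n, (k : ℕ) + 1 = n → 1 < (σ k).re) :
    Summable fun x => seqTerm σ (e x) := by
  refine summable_of_dominated e he hpos (Finset.univ.filter fun k : Fin n => (k : ℕ) + 1 = n) ?_
    σ hσ fun c hc => hlast c (Finset.mem_filter.1 hc).2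
  intro x k
  have hk := k.2
  refine ⟨⟨n - 1, by omega⟩, ?_, hmono x ?_⟩
  · simp only [Finset.mem_filter, Finset.mem_univ, true_and]
    omega
  · rw [Fin.le_def]
    simp only
    omega

/-! ### Passage to the limit -/

/-- A convergent series is the limit of its sums over an increasing exhaustion of the index set,
which may be embedded in a larger type by `e`. -/
theorem tendsto_finsum_mem_tsum {α β : Type*} {f : α → ℂ} (hf : Summable f) (e : α → β)
    (he : Function.Injective e) (g : β → ℂ) (hg : ∀ x, f x = g (e x)) (S : ℕ → Set β)
    (hfin : ∀ n, (S n).Finite) (hmono : Monotone S) (hsub : ∀ n, S n ⊆ Set.range e)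
    (hex : ∀ x, ∃ n, e x ∈ S n) :
    Tendsto (fun n => ∑ᶠ b ∈ S n, g b) atTop (𝓝 (∑' x, f x)) := by
  have hF : ∀ n, (e ⁻¹' S n).Finite := fun n => (hfin n).preimage he.injOn
  have h₁ : ∀ n, ∑ᶠ b ∈ S n, g b = ∑ x ∈ (hF n).toFinset, f x := fun n => by
    rw [← finsum_mem_eq_finite_toFinset_sum]
    refine (finsum_mem_eq_of_bijOn e ⟨fun x hx => hx, he.injOn, fun b hb => ?_⟩
      fun x _ => hg x).symm
    obtain ⟨x, rfl⟩ := hsub n hb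
    exact ⟨x, hb, rfl⟩
  simp only [h₁]
  refine hf.hasSum.comp (tendsto_atTop_finset_of_monotone (fun n n' h x hx => ?_) fun x => ?_)
  · rw [Set.Finite.mem_toFinset] at hx ⊢
    exact hmono h hx
  · simpa using hex x

theorem tendsto_fillingSum {μ : YoungDiagram} {s : Tableau μ ℂ}
    (hsum : Summable fun M : SSYT μ => schurTerm s M) (w : ℕ × ℕ → ℕ → ℂ)
    (hw : ∀ (c : μ.cells) (m : ℕ), w c.1 m = ((m : ℂ) ^ s c)⁻¹) :
    Tendsto (fun n => fillingSum w μ fun _ => n) atTop (𝓝 (schurZeta s)) := by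
  refine tendsto_finsum_mem_tsum hsum (fun M c => M.1 c.1 c.2) ?_ _ ?_ _
    (fun n => fillings_finite _ _) ?_ ?_ ?_
  · intro M M' h
    exact Subtype.ext (SemistandardYoungTableau.ext fun i j => congrFun h (i, j))
  · intro M
    rw [schurTerm, one_div, ← Finset.prod_inv_distrib,
      ← Finset.prod_coe_sort μ.cells fun c => w c (M.1 c.1 c.2)]
    exact Finset.prod_congr rfl fun c _ => (hw c _).symm
  · intro n n' h T hT
    exact mem_fillings_of_le hT fun c hc => ((hT.1 c hc).2).trans h
  · intro n T hT
    exact ⟨⟨⟨fun i j => T (i, j), fun h hc => hT.2.2.1 _ _ _ h hc,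
      fun h hc => hT.2.2.2 _ _ _ h hc, fun h => hT.2.1 _ h⟩, fun i j h => (hT.1 _ h).1⟩, rfl⟩
  · intro M
    refine ⟨μ.cells.sup fun c => M.1 c.1 c.2, fun c hc => ⟨M.2 _ _ hc, ?_⟩,
      fun c hc => M.1.zeros hc, fun i j₁ j₂ h hc => M.1.row_weak h hc,
      fun i₁ i₂ j h hc => M.1.col_strict h hc⟩
    exact Finset.le_sup (f := fun c : ℕ × ℕ => M.1 c.1 c.2) ((YoungDiagram.mem_cells c).2 hc)

theorem tendsto_seqSum_le {L : ℕ} (f : ℕ → ℂ)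
    (hsum : Summable fun m : WeakSeq L => seqTerm (fun k => f k) m.1) :
    Tendsto (fun n => seqSum (· ≤ ·) (fun k m => ((m : ℂ) ^ f k)⁻¹) L n) atTop
      (𝓝 (multipleZetaStar fun k : Fin L => f k)) := by
  refine tendsto_finsum_mem_tsum hsum (fun m => m.1) Subtype.val_injective _ ?_ _
    (fun n => boundedSeqs_finite _ _ _) ?_ ?_ ?_
  · intro m
    rw [seqTerm, one_div, ← Finset.prod_inv_distrib]
  · intro n n' h m hm
    exact ⟨hm.1, fun k => ⟨(hm.2 k).1, (hm.2 k).2.trans h⟩⟩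
  · intro n m hm
    exact ⟨⟨m, monotone_iff_forall_lt.2 fun i j h => hm.1 i j h, fun k => (hm.2 k).1⟩, rfl⟩
  · intro m
    exact ⟨Finset.univ.sup m.1, fun i j h => m.2.1 h.le,
      fun k => ⟨m.2.2 k, Finset.le_sup (Finset.mem_univ k)⟩⟩

theorem tendsto_seqSum_lt {L : ℕ} (f : ℕ → ℂ)
    (hsum : Summable fun m : StrictSeq L => seqTerm (fun k => f k) m.1) :
    Tendsto (fun n => seqSum (· < ·) (fun k m => ((m : ℂ) ^ f k)⁻¹) L n) atTop
      (𝓝 (multipleZeta fun k : Fin L => f k)) := by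
  refine tendsto_finsum_mem_tsum hsum (fun m => m.1) Subtype.val_injective _ ?_ _
    (fun n => boundedSeqs_finite _ _ _) ?_ ?_ ?_
  · intro m
    rw [seqTerm, one_div, ← Finset.prod_inv_distrib]
  · intro n n' h m hm
    exact ⟨hm.1, fun k => ⟨(hm.2 k).1, (hm.2 k).2.trans h⟩⟩
  · intro n m hm
    exact ⟨⟨m, fun i j h => hm.1 i j h, fun k => (hm.2 k).1⟩, rfl⟩
  · intro m
    exact ⟨Finset.univ.sup m.1, fun i j h => m.2.1 h,
      fun k => ⟨m.2.2 k, Finset.le_sup (Finset.mem_univ k)⟩⟩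

theorem tendsto_det_of_tendsto {d : ℕ} {A : ℕ → Matrix (Fin d) (Fin d) ℂ}
    {B : Matrix (Fin d) (Fin d) ℂ} (h : ∀ i j, Tendsto (fun n => A n i j) atTop (𝓝 (B i j))) :
    Tendsto (fun n => (A n).det) atTop (𝓝 B.det) :=
  ((continuous_id.matrix_det (n := Fin d) (R := ℂ)).tendsto B).comp
    (tendsto_pi_nhds.2 fun i => tendsto_pi_nhds.2 fun j => h i j)


theorem rowLen_pos_of_lt_colLen {μ : YoungDiagram} {i : ℕ} (h : i < μ.colLen 0) : 0 < μ.rowLen i :=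
  YoungDiagram.mem_iff_lt_rowLen.1 (YoungDiagram.mem_iff_lt_colLen.2 h)

/-- Every content between that of the last box of the first column and that of the last box of the
first row is the content of a box. -/
theorem one_le_re_of_content {μ : YoungDiagram} {s : Tableau μ ℂ} (hs : s ∈ region μ) {a : ℤ → ℂ}
    (ha : ∀ c : μ.cells, a ((c.1.2 : ℤ) - (c.1.1 : ℤ)) = s c) {k : ℤ} (h₁ : -k < μ.colLen 0)
    (h₂ : k < μ.rowLen 0) : 1 ≤ (a k).re := by
  have hre : ∀ c : μ.cells, 1 ≤ (s c).re := fun c => by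
    by_cases hc : IsCorner μ c.1
    · exact ((hs c).2 hc).le
    · exact (hs c).1 hc
  rcases le_or_gt 0 k with hk | hk
  · lift k to ℕ using hk
    have hmem : (0, k) ∈ μ := YoungDiagram.mem_iff_lt_rowLen.2 (by exact_mod_cast h₂)
    have := ha ⟨(0, k), hmem⟩
    simp only [Nat.cast_zero, sub_zero] at this
    rw [this]
    exact hre _
  · obtain ⟨l, rfl⟩ : ∃ l : ℕ, k = -(l : ℤ) := ⟨(-k).toNat, by omega⟩
    have hmem : (l, 0) ∈ μ := YoungDiagram.mem_iff_lt_colLen.2 (by omega)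
    have := ha ⟨(l, 0), hmem⟩
    simp only [Nat.cast_zero, zero_sub] at this
    rw [this]
    exact hre _

theorem summable_weakSeq_entry {μ : YoungDiagram} {s : Tableau μ ℂ} (hs : s ∈ region μ)
    {a : ℤ → ℂ} (ha : ∀ c : μ.cells, a ((c.1.2 : ℤ) - (c.1.1 : ℤ)) = s c)
    (hrow : ∀ c : μ.cells, c.1.2 + 1 = μ.rowLen c.1.1 → 1 < (s c).re) {i j : ℕ}
    (hi : i < μ.colLen 0) (hj : j < μ.colLen 0) :
    Summable fun m : WeakSeq ((μ.rowLen i : ℤ) - (i : ℤ) + (j : ℤ)).toNat =>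
      seqTerm (fun k => a (-(j : ℤ) + ((k : ℕ) : ℤ))) m.1 := by
  have hpos := rowLen_pos_of_lt_colLen hi
  refine summable_seqTerm (fun m : WeakSeq _ => m.1) Subtype.val_injective (fun m => m.2.1)
    (fun m => m.2.2) _ (fun k => ?_) (fun k hk => ?_)
  · have := μ.rowLen_anti 0 i (Nat.zero_le i)
    have hk := k.2
    exact one_le_re_of_content hs ha (by omega) (by omega)
  · have hmem : (i, μ.rowLen i - 1) ∈ μ := YoungDiagram.mem_iff_lt_rowLen.2 (by omega)
    have h := hrow ⟨_, hmem⟩ (by simp only; omega)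
    rw [← ha] at h
    convert h using 3
    simp only
    omega

theorem summable_strictSeq_entry {μ : YoungDiagram} {s : Tableau μ ℂ} (hs : s ∈ region μ)
    {a : ℤ → ℂ} (ha : ∀ c : μ.cells, a ((c.1.2 : ℤ) - (c.1.1 : ℤ)) = s c)
    (hcol : ∀ c : μ.cells, c.1.1 + 1 = μ.colLen c.1.2 → 1 < (s c).re) {i j : ℕ}
    (hi : i < μ.rowLen 0) (hj : j < μ.rowLen 0) :
    Summable fun m : StrictSeq ((μ.colLen i : ℤ) - (i : ℤ) + (j : ℤ)).toNat =>
      seqTerm (fun k => a ((j : ℤ) - ((k : ℕ) : ℤ))) m.1 := by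
  have hpos : 0 < μ.colLen i :=
    YoungDiagram.mem_iff_lt_colLen.1 (YoungDiagram.mem_iff_lt_rowLen.2 hi)
  refine summable_seqTerm (fun m : StrictSeq _ => m.1) Subtype.val_injective
    (fun m => m.2.1.monotone) (fun m => m.2.2) _ (fun k => ?_) (fun k hk => ?_)
  · have := μ.colLen_anti 0 i (Nat.zero_le i)
    have hk := k.2
    exact one_le_re_of_content hs ha (by omega) (by omega)
  · have hmem : (μ.colLen i - 1, i) ∈ μ := YoungDiagram.mem_iff_lt_colLen.2 (by omega)
    have h := hcol ⟨_, hmem⟩ (by simp only; omega)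
    rw [← ha] at h
    convert h using 3
    simp only
    omega

/-- The `H`-type formula, as the limit of the formulas for bounded tableaux. -/
theorem schurZeta_eq_det_zetaStar {μ : YoungDiagram} {s : Tableau μ ℂ} (hs : s ∈ region μ)
    {a : ℤ → ℂ} (ha : ∀ c : μ.cells, a ((c.1.2 : ℤ) - (c.1.1 : ℤ)) = s c)
    (hrow : ∀ c : μ.cells, c.1.2 + 1 = μ.rowLen c.1.1 → 1 < (s c).re) :
    schurZeta s = Matrix.det (Matrix.of fun i j : Fin (μ.colLen 0) =>
      zetaStarOfLength ((μ.rowLen i : ℤ) - ((i : ℕ) : ℤ) + ((j : ℕ) : ℤ))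
        (fun k => a (-((j : ℕ) : ℤ) + (k : ℤ)))) := by
  refine tendsto_nhds_unique (tendsto_fillingSum (summable_schurTerm hs)
    (fun c m => ((m : ℂ) ^ a ((c.2 : ℤ) - (c.1 : ℤ)))⁻¹) fun c m => by rw [ha]) ?_
  simp only [fun n => fillingSum_eq_det_rowLen (fun k m => ((m : ℂ) ^ a k)⁻¹) (μ.colLen 0) n μ
    le_rfl]
  refine tendsto_det_of_tendsto fun i j => ?_
  simp only [jacobiTrudi, Matrix.of_apply, seqSumInt, zetaStarOfLength]
  split_ifs
  · exact tendsto_const_nhds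
  · exact tendsto_seqSum_le (fun k => a (-((j : ℕ) : ℤ) + (k : ℤ)))
      (summable_weakSeq_entry hs ha hrow i.2 j.2)

/-- The `E`-type formula, as the limit of the formulas for bounded tableaux. -/
theorem schurZeta_eq_det_zeta {μ : YoungDiagram} {s : Tableau μ ℂ} (hs : s ∈ region μ)
    {a : ℤ → ℂ} (ha : ∀ c : μ.cells, a ((c.1.2 : ℤ) - (c.1.1 : ℤ)) = s c)
    (hcol : ∀ c : μ.cells, c.1.1 + 1 = μ.colLen c.1.2 → 1 < (s c).re) :
    schurZeta s = Matrix.det (Matrix.of fun i j : Fin (μ.rowLen 0) =>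
      zetaOfLength ((μ.colLen i : ℤ) - ((i : ℕ) : ℤ) + ((j : ℕ) : ℤ))
        (fun k => a (((j : ℕ) : ℤ) - (k : ℤ)))) := by
  refine tendsto_nhds_unique (tendsto_fillingSum (summable_schurTerm hs)
    (fun c m => ((m : ℂ) ^ a (-((c.1 : ℤ) - (c.2 : ℤ))))⁻¹)
    fun c m => by rw [neg_sub, ha]) ?_
  simp only [fun n => fillingSum_eq_det_colLen (fun k m => ((m : ℂ) ^ a (-k))⁻¹) (μ.rowLen 0) n μ
    le_rfl]
  refine tendsto_det_of_tendsto fun i j => ?_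
  simp only [jacobiTrudi, Matrix.of_apply, seqSumInt, zetaOfLength]
  split_ifs
  · exact tendsto_const_nhds
  · simp only [neg_add, neg_neg, ← sub_eq_add_neg]
    exact tendsto_seqSum_lt (fun k => a (((j : ℕ) : ℤ) - (k : ℤ)))
      (summable_strictSeq_entry hs ha hcol i.2 j.2)

end SchurZeta

/-- Jacobi–Trudi formulas of `H`-type and `E`-type for Schur multiple zeta functions, together with
the absolute convergence of all series that occur. In the numbering from `0`, the arguments
`a_{-j+1}, …, a_{-j+L}` read `a (-j + k)` and the arguments `a_{j-1}, …, a_{j-L}` read `a (j - k)`,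
both for `0 ≤ k < L`. -/
theorem theorem1p1 (μ : YoungDiagram) (s : SchurZeta.Tableau μ ℂ)
    (hs : s ∈ SchurZeta.diagRegion μ) (a : ℤ → ℂ)
    (ha : ∀ c : μ.cells, a ((c.1.2 : ℤ) - (c.1.1 : ℤ)) = s c) :
    Summable (fun M : SchurZeta.SSYT μ => SchurZeta.schurTerm s M) ∧
    ((∀ c : μ.cells, c.1.2 + 1 = μ.rowLen c.1.1 → 1 < (s c).re) →
      (∀ i j : Fin (μ.colLen 0),
        Summable (fun m : SchurZeta.WeakSeq
            ((μ.rowLen i : ℤ) - ((i : ℕ) : ℤ) + ((j : ℕ) : ℤ)).toNat =>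
          SchurZeta.seqTerm (fun k => a (-((j : ℕ) : ℤ) + ((k : ℕ) : ℤ))) m.1)) ∧
      SchurZeta.schurZeta s =
        Matrix.det (Matrix.of fun i j : Fin (μ.colLen 0) =>
          SchurZeta.zetaStarOfLength ((μ.rowLen i : ℤ) - ((i : ℕ) : ℤ) + ((j : ℕ) : ℤ))
            (fun k => a (-((j : ℕ) : ℤ) + (k : ℤ))))) ∧
    ((∀ c : μ.cells, c.1.1 + 1 = μ.colLen c.1.2 → 1 < (s c).re) →
      (∀ i j : Fin (μ.rowLen 0),
        Summable (fun m : SchurZeta.StrictSeq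
            ((μ.colLen i : ℤ) - ((i : ℕ) : ℤ) + ((j : ℕ) : ℤ)).toNat =>
          SchurZeta.seqTerm (fun k => a (((j : ℕ) : ℤ) - ((k : ℕ) : ℤ))) m.1)) ∧
      SchurZeta.schurZeta s =
        Matrix.det (Matrix.of fun i j : Fin (μ.rowLen 0) =>
          SchurZeta.zetaOfLength ((μ.colLen i : ℤ) - ((i : ℕ) : ℤ) + ((j : ℕ) : ℤ))
            (fun k => a (((j : ℕ) : ℤ) - (k : ℤ))))) :=
  ⟨SchurZeta.summable_schurTerm hs.1,
    fun h => ⟨fun i j => SchurZeta.summable_weakSeq_entry hs.1 ha h i.2 j.2,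
      SchurZeta.schurZeta_eq_det_zetaStar hs.1 ha h⟩,
    fun h => ⟨fun i j => SchurZeta.summable_strictSeq_entry hs.1 ha h i.2 j.2,
      SchurZeta.schurZeta_eq_det_zeta hs.1 ha h⟩⟩
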